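/- Let $K, f \ge 1$ and $\alpha \in [K] = \{1,\dots,K\}$ be integers. In the symmetric $(K,\alpha,f)$ file demand set structure, a library of $N = f\binom{K}{\alpha}$ files of $B$ bits each consists of the files $W_{i,\mathcal{S}}$, $i \in [f]$, $\mathcal{S} \subseteq [K]$, $|\mathcal{S}| = \alpha$, and a demand in which user $k \in [K]$ requests $W_{f_k,\mathcal{D}_k}$ is valid if $k \in \mathcal{D}_k$ for all $k \in [K]$. A placement is uncoded and selfish if each user $k$ stores at most $MB$ bits of the library, uncoded, and stores bits of $W_{i,\mathcal{S}}$ only if $k \in \mathcal{S}$. The pair $(M,R)$ is achievable if, for some $B \ge 1$, there is such a placement, chosen without knowledge of the demand, for which every valid demand can be served by broadcasting at most $RB$ bits: for every content of the library, each user recovers its requested file without error from the broadcast and its own cache. Let $R^\star(t)$ be the infimum of the $R$ such that $(M,R)$ is achievable at $M = tN/K$, and put $$R_{\text{MAN}}(t) = \frac{\binom{K}{t+1}}{\binom{K}{t}}, \qquad R_{\text{LB}}(t) = \frac{\binom{\alpha}{t+1} + (K-\alpha)\binom{\alpha-1}{t}}{\binom{\alpha}{t}},$$ the load of unselfish (Maddah-Ali--Niesen)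 coded caching and the converse expression, respectively. If $\alpha \in [K-1]$, then $$\frac{R^\star(t)}{R_{\text{MAN}}(t)} \ge 1 \quad \text{for all integers } 0 \le t \le \alpha - 1, \qquad \frac{R^\star(t)}{R_{\text{MAN}}(t)} > 1 \quad \text{for all integers } 0 < t < \alpha - 1.$$ More precisely, for all integers $0 \le t \le \alpha-1$, $$\frac{R^\star(t)}{R_{\text{MAN}}(t)} \ge \frac{R_{\text{LB}}(t)}{R_{\text{MAN}}(t)} = 1 + \frac{t(K-\alpha)(\alpha-1-t)}{\alpha(K-t)}.$$ If $\alpha = K$, then $R_{\text{LB}}(t) = R_{\text{MAN}}(t)$ for all integers $0 \le t \le K$. -/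

import Mathlib

namespace SelfishCaching

/-- A file `W_{i,S}` of the symmetric `(K, α, f)` structure: an index `i` among the `f` files of a
class, and the set `S` of the `α` users that are interested in the class. -/
abbrev LibFile (K α f : ℕ) : Type :=
  Fin f × {S : Finset (Fin K) // S.card = α}

/-- The number `N` of files in the library. -/
def numFiles (K α f : ℕ) : ℕ := f * K.choose α

theorem card_libFile (K α f : ℕ) : Fintype.card (LibFile K α f) = numFiles K α f := by
  simp [LibFile, numFiles, Fintype.card_prod, Fintype.card_finset_len]

/-- A realization of the whole library, every file having `B` bits. -/
abbrev Content (K α f B : ℕ) : Type := LibFile K α f → Fin B → Bool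

/-- An uncoded placement: each user stores a set of bits of the library. A bit is addressed by its
file and its position in the file. -/
abbrev Placement (K α f B : ℕ) : Type := Fin K → Finset (LibFile K α f × Fin B)

/-- User `k` stores bits of `W_{i,S}` only if `k ∈ S`. -/
def IsSelfish {K α f B : ℕ} (Z : Placement K α f B) : Prop :=
  ∀ k, ∀ p ∈ Z k, k ∈ p.1.2.1

/-- Each cache has size `M` files, that is `M * B` bits. -/
def FitsMemory {K α f B : ℕ} (Z : Placement K α f B) (M : ℝ) : Prop :=
  ∀ k, ((Z k).card : ℝ) ≤ M * B

/-- What user `k` finds in its cache when the library content is `W`. -/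
def cacheContent {K α f B : ℕ} (Z : Placement K α f B) (W : Content K α f B) (k : Fin K) :
    Z k → Bool :=
  fun p => W p.1.1 p.1.2

/-- A demand: user `k` requests the file `d k`. -/
abbrev Demand (K α f : ℕ) : Type := Fin K → LibFile K α f

/-- In a valid demand every user requests a file of its own file demand set. -/
def Demand.IsValid {K α f : ℕ} (d : Demand K α f) : Prop := ∀ k, k ∈ (d k).2.1

/-- Given the placement `Z`, a broadcast of `l` bits can serve the demand `d`: whatever the library
content is, each user recovers the file it requests from the broadcast and its own cache. -/
def CanServe {K α f B : ℕ} (Z : Placement K α f B) (d : Demand K α f) (l : ℕ) : Prop :=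
  ∃ (encode : Content K α f B → (Fin l → Bool))
    (decode : ∀ k : Fin K, (Fin l → Bool) → (Z k → Bool) → (Fin B → Bool)),
    ∀ (W : Content K α f B) (k : Fin K),
      decode k (encode W) (cacheContent Z W k) = W (d k)

/-- The memory-load pair `(M, R)` is achievable under uncoded and selfish placement: for some file
size, some such placement of memory `M` allows every valid demand to be served with at most `R * B`
transmitted bits. -/
def Achievable (K α f : ℕ) (M R : ℝ) : Prop :=
  ∃ B : ℕ, 0 < B ∧ ∃ Z : Placement K α f B, IsSelfish Z ∧ FitsMemory Z M ∧
    ∀ d : Demand K α f, d.IsValid → ∃ l : ℕ, (l : ℝ) ≤ R * B ∧ CanServe Z d l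

/-- The optimal worst-case load of selfish coded caching with uncoded placement, as a function of
the cache size `M`. -/
noncomputable def optimalLoad (K α f : ℕ) (M : ℝ) : ℝ :=
  sInf {R : ℝ | Achievable K α f M R}

/-- The optimal load `R*(t)` at cache redundancy `t = K M / N`, that is at `M = t N / K`. -/
noncomputable def Rstar (K α f t : ℕ) : ℝ :=
  optimalLoad K α f ((t : ℝ) * (numFiles K α f : ℝ) / (K : ℝ))

/-- The load of unselfish (Maddah-Ali--Niesen) coded caching at cache redundancy `t`. -/
noncomputable def RMAN (K t : ℕ) : ℝ :=
  (K.choose (t + 1) : ℝ) / (K.choose t : ℝ)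

/-- The converse expression at its corner point of cache redundancy `t`. -/
noncomputable def RLB (K α t : ℕ) : ℝ :=
  ((α.choose (t + 1) : ℝ) + ((K : ℝ) - (α : ℝ)) * ((α - 1).choose t : ℝ)) / (α.choose t : ℝ)

end SelfishCaching

/-! The heart is the bound `RLB K α t ≤ R` for every achievable `R`; the ratio is then algebra. Fix
an order `π` of the users and let the user at position `a` request a file whose class is the cyclic
interval of `α` positions from `a`. For `α < K` these files are distinct, so decoding along the
order forces transmission of every bit cached only in the non-wrapping tail after `a`
(`CanServe.card_uncached_le`, `sum_card_cover_le`).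

Summing over all `π` and file indices removes the dependence on the placement: by symmetry, the
number of times a bit is counted depends only on how many users cache it, and with `τ` cachers it is
`K! * RLB K α τ / K.choose α` (`coverCount_mul`, `sum_coverCount`). So the average of `RLB` over all
bits is at most `R`. The mean number of cachers is at most `t`, and `RLB` is convex and decreasing,
so a tangent line at `t` finishes the argument. -/

namespace SelfishCaching

open Finset

/-! ### Decoding along an order of the users -/

/-- Bits of the requested files that are not cached by any user up to the requester in the order
`π` have to be transmitted. -/
theorem CanServe.card_uncached_le {K α f B l : ℕ} {Z : Placement K α f B} {d : Demand K α f}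
    (h : CanServe Z d l) (π : Equiv.Perm (Fin K)) :
    (univ.filter fun p : LibFile K α f × Fin B =>
      ∃ a, d (π a) = p.1 ∧ ∀ c ≤ a, p ∉ Z (π c)).card ≤ l := by
  classical
  obtain ⟨enc, dec, hdec⟩ := h
  set A := univ.filter fun p : LibFile K α f × Fin B =>
      ∃ a, d (π a) = p.1 ∧ ∀ c ≤ a, p ∉ Z (π c) with hA
  let w : Finset (LibFile K α f × Fin B) → Content K α f B := fun U x b => decide ((x, b) ∈ U)
  -- Libraries vanishing off `A` with equal broadcasts agree on all requested files: any bit of `A`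
  -- in the cache of `π a` belongs to a file requested earlier in the order. Hence `2 ^ A.card ≤ 2 ^
  -- l`.
  have key : ∀ U ⊆ A, ∀ V ⊆ A, enc (w U) = enc (w V) →
      ∀ a : Fin K, w U (d (π a)) = w V (d (π a)) := by
    intro U hU V hV he a
    induction a using WellFoundedLT.induction with
    | ind a ih =>
      rw [← hdec (w U) (π a), ← hdec (w V) (π a), he]
      congr 1
      funext ⟨p, hp⟩
      by_cases hpA : p ∈ A
      · obtain ⟨a', ha', hc⟩ := (mem_filter.1 hpA).2
        have hlt : a' < a := by
          by_contra hle
          exact hc a (not_lt.1 hle) hp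
        have := congrFun (ih a' hlt) p.2
        simpa [cacheContent, ha'] using this
      · have h1 : p ∉ U := fun hx => hpA (hU hx)
        have h2 : p ∉ V := fun hx => hpA (hV hx)
        simp [cacheContent, w, h1, h2]
  have hinj : Set.InjOn (fun U => enc (w U)) (A.powerset : Set (Finset _)) := by
    intro U hU V hV he
    have hU' := mem_powerset.1 (mem_coe.1 hU)
    have hV' := mem_powerset.1 (mem_coe.1 hV)
    have hk := key U hU' V hV' he
    ext p
    by_cases hpA : p ∈ A
    · obtain ⟨a, ha, -⟩ := (mem_filter.1 hpA).2
      have := congrFun (hk a) p.2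
      simpa [ha, w] using this
    · exact ⟨fun hx => absurd (hU' hx) hpA, fun hx => absurd (hV' hx) hpA⟩
  have hcard := card_le_card_of_injOn (t := (univ : Finset (Fin l → Bool)))
    (fun U => enc (w U)) (fun _ _ => mem_univ _) hinj
  rw [card_powerset, card_univ, Fintype.card_fun, Fintype.card_bool, Fintype.card_fin] at hcard
  exact (Nat.pow_le_pow_iff_right (by norm_num)).1 hcard

/-! ### Counting permutations by symmetry -/

/-- Membership in the two nested sets cuts `V` into fibres of matching sizes; bijections of the
fibres glue to a permutation. -/
theorem exists_perm_map_eq {V : Type*} [Fintype V] [DecidableEq V] {S T S' T' : Finset V}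
    (hT : T ⊆ S) (hT' : T' ⊆ S') (hS : S.card = S'.card) (hc : T.card = T'.card) :
    ∃ σ : Equiv.Perm V, S.map σ.toEmbedding = S' ∧ T.map σ.toEmbedding = T' := by
  classical
  have hfib : ∀ c : Bool × Bool,
      Nonempty ({a // (decide (a ∈ S), decide (a ∈ T)) = c} ≃
        {a // (decide (a ∈ S'), decide (a ∈ T')) = c}) := by
    have hd := card_sdiff_of_subset hT
    have hd' := card_sdiff_of_subset hT'
    have hcc := card_compl S
    have hcc' := card_compl S'
    rintro ⟨x, y⟩
    refine ⟨Fintype.equivOfCardEq ?_⟩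
    rw [Fintype.card_subtype, Fintype.card_subtype]
    cases x <;> cases y
    · have e1 : (univ.filter fun a => (decide (a ∈ S), decide (a ∈ T)) = (false, false)) = Sᶜ := by
        ext a; have := @hT a; simp; tauto
      have e2 : (univ.filter fun a => (decide (a ∈ S'), decide (a ∈ T')) = (false, false)) =
          S'ᶜ := by
        ext a; have := @hT' a; simp; tauto
      rw [e1, e2]; omega
    · have e1 : (univ.filter fun a => (decide (a ∈ S), decide (a ∈ T)) = (false, true)) = ∅ := by
        ext a; have := @hT a; simp; tauto
      have e2 : (univ.filter fun a => (decide (a ∈ S'), decide (a ∈ T')) = (false, true)) =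
          ∅ := by
        ext a; have := @hT' a; simp; tauto
      rw [e1, e2]
    · have e1 : (univ.filter fun a => (decide (a ∈ S), decide (a ∈ T)) = (true, false)) =
          S \ T := by
        ext a; simp
      have e2 : (univ.filter fun a => (decide (a ∈ S'), decide (a ∈ T')) = (true, false)) =
          S' \ T' := by
        ext a; simp
      rw [e1, e2]; omega
    · have e1 : (univ.filter fun a => (decide (a ∈ S), decide (a ∈ T)) = (true, true)) = T := by
        ext a; have := @hT a; simp; tauto
      have e2 : (univ.filter fun a => (decide (a ∈ S'), decide (a ∈ T')) = (true, true)) = T' := by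
        ext a; have := @hT' a; simp; tauto
      rw [e1, e2]; omega
  let σ : Equiv.Perm V := Equiv.ofFiberEquiv fun c => (hfib c).some
  have hσ : ∀ a, (decide (σ a ∈ S'), decide (σ a ∈ T')) = (decide (a ∈ S), decide (a ∈ T)) :=
    fun a => Equiv.ofFiberEquiv_map (f := fun a => (decide (a ∈ S), decide (a ∈ T)))
      (g := fun a => (decide (a ∈ S'), decide (a ∈ T'))) (fun c => (hfib c).some) a
  have h1 : ∀ a, (σ a ∈ S' ↔ a ∈ S) ∧ (σ a ∈ T' ↔ a ∈ T) := by
    intro a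
    have := hσ a
    simpa only [Prod.mk.injEq, decide_eq_decide] using this
  refine ⟨σ, ?_, ?_⟩
  · refine Finset.ext fun b => ?_
    rw [mem_map_equiv, ← (h1 _).1, Equiv.apply_symm_apply]
  · refine Finset.ext fun b => ?_
    rw [mem_map_equiv, ← (h1 _).2, Equiv.apply_symm_apply]

/-- The number of permutations that map `I` to `S` and whose image of `Q` covers `T`. -/
def coverCount {V : Type*} [Fintype V] [DecidableEq V] (I Q S T : Finset V) : ℕ :=
  (univ.filter fun π : Equiv.Perm V =>
    I.map π.toEmbedding = S ∧ T ⊆ Q.map π.toEmbedding).card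

theorem coverCount_map {V : Type*} [Fintype V] [DecidableEq V] (I Q S T : Finset V)
    (σ : Equiv.Perm V) :
    coverCount I Q (S.map σ.toEmbedding) (T.map σ.toEmbedding) = coverCount I Q S T := by
  refine (card_bij (fun π _ => σ * π) ?_ ?_ ?_).symm
  · intro π hπ
    obtain ⟨h1, h2⟩ := (mem_filter.1 hπ).2
    refine mem_filter.2 ⟨mem_univ _, ?_, ?_⟩
    · rw [← h1, map_map]; rfl
    · have : Q.map (σ * π).toEmbedding = (Q.map π.toEmbedding).map σ.toEmbedding := by
        rw [map_map]; rfl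
      rw [this]
      exact map_subset_map.2 h2
  · intro π _ π' _ h
    exact mul_left_cancel h
  · intro π hπ
    obtain ⟨h1, h2⟩ := (mem_filter.1 hπ).2
    have e : ∀ X : Finset V, (X.map (σ⁻¹ * π).toEmbedding).map σ.toEmbedding =
        X.map π.toEmbedding := by
      intro X
      rw [map_map]
      congr 1
      ext a
      simp
    refine ⟨σ⁻¹ * π, mem_filter.2 ⟨mem_univ _, ?_, ?_⟩, by simp⟩
    · exact map_injective σ.toEmbedding (by rw [e, h1])
    · rw [← map_subset_map (f := σ.toEmbedding), e]
      exact h2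

/-- Double count triples `(π, X, Y)` with `Y ⊆ X`. All pairs `(X, Y)` of the given sizes contribute
equally; each `π` determines `X` and leaves `Y` free among the subsets of the image of `Q`. -/
theorem coverCount_mul {V : Type*} [Fintype V] [DecidableEq V] {I Q S T : Finset V}
    (hQ : Q ⊆ I) (hT : T ⊆ S) (hS : S.card = I.card) :
    coverCount I Q S T * ((Fintype.card V).choose I.card * I.card.choose T.card) =
      (Fintype.card V).factorial * Q.card.choose T.card := by
  have h1 : ∑ X ∈ powersetCard I.card (univ : Finset V), ∑ Y ∈ powersetCard T.card X,
      coverCount I Q X Y =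
      coverCount I Q S T * ((Fintype.card V).choose I.card * I.card.choose T.card) := by
    have : ∀ X ∈ powersetCard I.card (univ : Finset V), ∑ Y ∈ powersetCard T.card X,
        coverCount I Q X Y = I.card.choose T.card * coverCount I Q S T := by
      intro X hX
      have hX := (mem_powersetCard.1 hX).2
      rw [sum_congr rfl (g := fun _ => coverCount I Q S T), sum_const, card_powersetCard, hX,
        smul_eq_mul]
      intro Y hY
      obtain ⟨hYX, hYc⟩ := mem_powersetCard.1 hY
      obtain ⟨σ, rfl, rfl⟩ := exists_perm_map_eq hT hYX (hS.trans hX.symm) hYc.symm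
      exact coverCount_map I Q S T σ
    rw [sum_congr rfl this, sum_const, card_powersetCard, card_univ, smul_eq_mul]
    ring
  rw [← h1]
  have h2 : ∀ X Y : Finset V, coverCount I Q X Y = ∑ π : Equiv.Perm V,
      if I.map π.toEmbedding = X then (if Y ⊆ Q.map π.toEmbedding then 1 else 0) else 0 := by
    intro X Y
    rw [coverCount, card_filter]
    refine sum_congr rfl fun π _ => ?_
    by_cases h : I.map π.toEmbedding = X <;> simp [h]
  simp_rw [h2]
  rw [sum_congr rfl fun X _ => sum_comm, sum_comm, sum_congr rfl (g := fun _ => Q.card.choose T.card)]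
  · rw [sum_const, card_univ, Fintype.card_perm, smul_eq_mul]
  intro π _
  rw [sum_eq_single (I.map π.toEmbedding)]
  · simp only [if_true]
    rw [← card_filter]
    have : (powersetCard T.card (I.map π.toEmbedding)).filter (fun Y => Y ⊆ Q.map π.toEmbedding) =
        powersetCard T.card (Q.map π.toEmbedding) := by
      ext Y
      simp only [mem_filter, mem_powersetCard]
      have := @map_subset_map _ _ π.toEmbedding Q I
      constructor
      · rintro ⟨⟨_, h⟩, h'⟩; exact ⟨h', h⟩
      · rintro ⟨h', h⟩; exact ⟨⟨h'.trans (this.2 hQ), h⟩, h'⟩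
    rw [this, card_powersetCard, card_map]
  · intro X _ hX
    exact sum_eq_zero fun _ _ => if_neg (Ne.symm hX)
  · intro h
    exact absurd (mem_powersetCard.2 ⟨subset_univ _, card_map _⟩) h

/-! ### Cyclic intervals and their tails -/

/-- The cyclic interval of length `α` starting at `a`. -/
def cyclicInterval (K α : ℕ) (a : Fin K) : Finset (Fin K) :=
  univ.filter fun b => (a.val ≤ b.val ∧ b.val < a.val + α) ∨ b.val + K < a.val + α

/-- The part of the cyclic interval starting at `a` that comes after `a` without wrapping. -/
def cyclicTail (K α : ℕ) (a : Fin K) : Finset (Fin K) :=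
  univ.filter fun b => a.val < b.val ∧ b.val < a.val + α

theorem card_filter_fin_val (K : ℕ) (p : ℕ → Prop) [DecidablePred p] :
    (univ.filter fun b : Fin K => p b.val).card = ((range K).filter p).card := by
  rw [card_filter, card_filter, Fin.sum_univ_eq_sum_range (fun i => if p i then 1 else 0)]

theorem card_cyclicInterval {K α : ℕ} (h : α ≤ K) (a : Fin K) :
    (cyclicInterval K α a).card = α := by
  rw [cyclicInterval, card_filter_fin_val K
    (fun b => (a.val ≤ b ∧ b < a.val + α) ∨ b + K < a.val + α)]
  have ha := a.isLt
  have : (range K).filter (fun b => (a.val ≤ b ∧ b < a.val + α) ∨ b + K < a.val + α) =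
      Ico a.val (min K (a.val + α)) ∪ range (a.val + α - K) := by
    ext b; simp only [mem_filter, mem_range, mem_union, mem_Ico]; omega
  rw [this, card_union_of_disjoint, Nat.card_Ico, card_range]
  · omega
  · rw [disjoint_left]
    intro b; simp only [mem_range, mem_Ico]; omega

theorem card_cyclicTail (K α : ℕ) (a : Fin K) :
    (cyclicTail K α a).card = min (α - 1) (K - 1 - a.val) := by
  rw [cyclicTail, card_filter_fin_val K (fun b => a.val < b ∧ b < a.val + α)]
  have ha := a.isLt
  have : (range K).filter (fun b => a.val < b ∧ b < a.val + α) =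
      Ico (a.val + 1) (min K (a.val + α)) := by
    ext b; simp only [mem_filter, mem_range, mem_Ico]; omega
  rw [this, Nat.card_Ico]
  omega

theorem cyclicTail_subset (K α : ℕ) (a : Fin K) : cyclicTail K α a ⊆ cyclicInterval K α a := by
  intro b
  simp only [cyclicTail, cyclicInterval, mem_filter, mem_univ, true_and]
  omega

theorem cyclicInterval_injective {K α : ℕ} (h0 : 1 ≤ α) (h : α < K) :
    Function.Injective (cyclicInterval K α) := by
  have key : ∀ a b : Fin K, a < b → cyclicInterval K α a ≠ cyclicInterval K α b := by
    intro a b hab he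
    have hm : ∀ c : Fin K, (c ∈ cyclicInterval K α a ↔ c ∈ cyclicInterval K α b) := by simp [he]
    simp only [cyclicInterval, mem_filter, mem_univ, true_and] at hm
    have h1 := hm b
    have hb := b.isLt
    -- The position before `b` separates the intervals: it would lie in the one from `b` only if `α
    -- ≥ K`.
    have h2 := hm ⟨b.val - 1, by omega⟩
    have hab' : a.val < b.val := hab
    simp only at h2
    omega
  intro a b he
  rcases lt_trichotomy a b with hab | hab | hab
  · exact absurd he (key a b hab)
  · exact hab
  · exact absurd he.symm (key b a hab)

/-- The terms `i < α` form a hockey-stick sum; the other `m` are constant. -/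
theorem sum_range_choose_min (α m τ : ℕ) (h0 : 1 ≤ α) :
    ∑ i ∈ range (α + m), (min (α - 1) i).choose τ =
      α.choose (τ + 1) + m * (α - 1).choose τ := by
  induction m with
  | zero =>
    rw [add_zero, zero_mul, add_zero]
    have : ∀ n, ∑ i ∈ range n, i.choose τ = n.choose (τ + 1) := by
      intro n
      induction n with
      | zero => simp
      | succ n ih => rw [sum_range_succ, ih, Nat.choose_succ_succ, add_comm]
    rw [← this]
    refine sum_congr rfl fun i hi => ?_
    rw [min_eq_right]
    have := mem_range.1 hi
    omega
  | succ m ih =>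
    rw [← add_assoc, sum_range_succ, ih, min_eq_left (by omega)]
    ring

theorem sum_choose_card_cyclicTail {K α : ℕ} (h0 : 1 ≤ α) (h : α ≤ K) (τ : ℕ) :
    ∑ a : Fin K, (cyclicTail K α a).card.choose τ =
      α.choose (τ + 1) + (K - α) * (α - 1).choose τ := by
  simp_rw [card_cyclicTail]
  rw [Fin.sum_univ_eq_sum_range (fun a => (min (α - 1) (K - 1 - a)).choose τ),
    sum_range_reflect (fun a => (min (α - 1) a).choose τ) K]
  have := sum_range_choose_min α (K - α) τ h0
  rwa [Nat.add_sub_cancel' h] at this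

/-! ### Closed forms and convexity -/

theorem RLB_eq {K α t : ℕ} (h0 : 1 ≤ α) (ht : t ≤ α) :
    RLB K α t = ((α : ℝ) - t) / (t + 1) + ((K : ℝ) - α) * (α - t) / α := by
  have hpos : (0 : ℝ) < α.choose t := by exact_mod_cast Nat.choose_pos ht
  have hα : (0 : ℝ) < α := by exact_mod_cast h0
  have ht1 : (0 : ℝ) < (t : ℝ) + 1 := by positivity
  have e1 : (α.choose (t + 1) : ℝ) * (t + 1) = α.choose t * (α - t) := by
    have := Nat.choose_succ_right_eq α t
    rw [← Nat.cast_sub ht]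
    exact_mod_cast this
  have e2 : ((α - 1).choose t : ℝ) * α = α.choose t * (α - t) := by
    obtain ⟨n, rfl⟩ : ∃ n, α = n + 1 := ⟨α - 1, by omega⟩
    have := Nat.choose_mul_succ_eq n t
    rw [← Nat.cast_sub ht, Nat.add_sub_cancel]
    exact_mod_cast this
  have e1' : (α.choose (t + 1) : ℝ) = α.choose t * (α - t) / (t + 1) := by
    field_simp; linarith
  have e2' : ((α - 1).choose t : ℝ) = α.choose t * (α - t) / α := by
    field_simp; linarith
  rw [RLB, e1', e2']
  field_simp

theorem RMAN_eq {K t : ℕ} (ht : t ≤ K) : RMAN K t = ((K : ℝ) - t) / (t + 1) := by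
  have hpos : (0 : ℝ) < K.choose t := by exact_mod_cast Nat.choose_pos ht
  have ht1 : (0 : ℝ) < (t : ℝ) + 1 := by positivity
  have e1 : (K.choose (t + 1) : ℝ) * (t + 1) = K.choose t * (K - t) := by
    have := Nat.choose_succ_right_eq K t
    rw [← Nat.cast_sub ht]
    exact_mod_cast this
  rw [RMAN, div_eq_div_iff hpos.ne' ht1.ne', e1]
  ring

theorem RLB_div_RMAN {K α t : ℕ} (h0 : 1 ≤ α) (h : α < K) (ht : t ≤ α - 1) :
    RLB K α t / RMAN K t =
      1 + (t : ℝ) * ((K : ℝ) - α) * ((α : ℝ) - 1 - t) / ((α : ℝ) * ((K : ℝ) - t)) := by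
  rw [RLB_eq h0 (by omega), RMAN_eq (by omega)]
  have hα : (0 : ℝ) < α := by exact_mod_cast h0
  have ht1 : (0 : ℝ) < (t : ℝ) + 1 := by positivity
  have hKt : (0 : ℝ) < (K : ℝ) - t := by
    have : t < K := by omega
    exact sub_pos.2 (by exact_mod_cast this)
  field_simp
  ring

/-- The tangent line of the convex function `RLB K α` at `t` is a lower bound. -/
theorem exists_tangent_le_RLB {K α t : ℕ} (h0 : 1 ≤ α) (h : α ≤ K) (ht : t ≤ α) :
    ∃ s : ℝ, 0 ≤ s ∧ ∀ τ ≤ α, RLB K α t + s * ((t : ℝ) - τ) ≤ RLB K α τ := by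
  have hα : (0 : ℝ) < α := by exact_mod_cast h0
  have hK : (α : ℝ) ≤ K := by exact_mod_cast h
  have ht1 : (0 : ℝ) < (t : ℝ) + 1 := by positivity
  -- Minus the derivative at `t` of `RLB`, written as `(α + 1) / (τ + 1) - 1 + (K - α) * (1 - τ /
  -- α)`.
  refine ⟨(α + 1) / (t + 1) ^ 2 + (K - α) / α, by
    have : (0 : ℝ) ≤ K - α := by linarith
    positivity, fun τ hτ => ?_⟩
  have hτ1 : (0 : ℝ) < (τ : ℝ) + 1 := by positivity
  rw [RLB_eq h0 ht, RLB_eq h0 hτ, ← sub_nonneg]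
  have : ((α : ℝ) - τ) / (τ + 1) + (K - α) * (α - τ) / α -
      ((α - t) / (t + 1) + (K - α) * (α - t) / α +
        ((α + 1) / (t + 1) ^ 2 + (K - α) / α) * ((t : ℝ) - τ)) =
      (α + 1) * ((t : ℝ) - τ) ^ 2 / ((τ + 1) * (t + 1) ^ 2) := by
    field_simp
    ring
  rw [this]
  positivity

/-! ### Cyclic demands and averaging -/

/-- The demand in which the user at position `a` of the order `π` requests the `i`-th file of the
class of the image of the cyclic interval starting at `a`. -/
def cyclicDemand {K α f : ℕ} (h : α ≤ K) (π : Equiv.Perm (Fin K)) (i : Fin f) : Demand K α f :=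
  fun k => (i, ⟨(cyclicInterval K α (π.symm k)).map π.toEmbedding, by
    rw [card_map, card_cyclicInterval h]⟩)

theorem cyclicDemand_isValid {K α f : ℕ} (h0 : 1 ≤ α) (h : α ≤ K) (π : Equiv.Perm (Fin K))
    (i : Fin f) : (cyclicDemand h π i : Demand K α f).IsValid := by
  intro k
  simp only [cyclicDemand, mem_map_equiv, cyclicInterval, mem_filter, mem_univ, true_and]
  omega

/-- The users that store the bit `p`. -/
def cachers {K α f B : ℕ} (Z : Placement K α f B) (p : LibFile K α f × Fin B) : Finset (Fin K) :=
  univ.filter fun k => p ∈ Z k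

theorem IsSelfish.cachers_subset {K α f B : ℕ} {Z : Placement K α f B} (hZ : IsSelfish Z)
    (p : LibFile K α f × Fin B) : cachers Z p ⊆ p.1.2.1 :=
  fun k hk => hZ k p (mem_filter.1 hk).2

theorem sum_card_cachers {K α f B : ℕ} (Z : Placement K α f B) :
    ∑ p, (cachers Z p).card = ∑ k, (Z k).card := by
  simp_rw [cachers, card_filter]
  rw [sum_comm]
  refine sum_congr rfl fun k _ => ?_
  rw [← card_filter, filter_univ_mem]

theorem sum_card_cover_le {K α f B l : ℕ} (h0 : 1 ≤ α) (h : α < K) {Z : Placement K α f B}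
    (π : Equiv.Perm (Fin K)) (i : Fin f)
    (hs : CanServe Z (cyclicDemand h.le π i) l) :
    ∑ a : Fin K, (univ.filter fun p : LibFile K α f × Fin B => p.1.1 = i ∧
      (cyclicInterval K α a).map π.toEmbedding = p.1.2.1 ∧
        cachers Z p ⊆ (cyclicTail K α a).map π.toEmbedding).card ≤ l := by
  classical
  rw [← card_biUnion]
  · refine (card_le_card ?_).trans (hs.card_uncached_le π)
    intro p hp
    obtain ⟨a, -, ha⟩ := mem_biUnion.1 hp
    obtain ⟨-, h1, h2, h3⟩ := mem_filter.1 ha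
    refine mem_filter.2 ⟨mem_univ _, a, ?_, ?_⟩
    · refine Prod.ext h1.symm (Subtype.ext ?_)
      simpa [cyclicDemand] using h2
    -- Cachers lie in the tail, strictly after `a`, so no user up to `a` stores the bit.
    · intro c hc hpc
      have := h3 (mem_filter.2 ⟨mem_univ (π c), hpc⟩)
      simp only [mem_map_equiv, Equiv.symm_apply_apply, cyclicTail, mem_filter, mem_univ,
        true_and] at this
      have hc' : c.val ≤ a.val := hc
      omega
  · intro a _ b _ hab
    refine disjoint_left.2 ?_
    intro p hp hp'
    have h1 := (mem_filter.1 hp).2.2.1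
    have h2 := (mem_filter.1 hp').2.2.1
    exact hab (cyclicInterval_injective h0 h (map_injective π.toEmbedding (h1.trans h2.symm)))

theorem sum_coverCount {K α : ℕ} (h0 : 1 ≤ α) (h : α ≤ K) (S T : Finset (Fin K))
    (hS : S.card = α) (hT : T ⊆ S) :
    ((∑ a, coverCount (cyclicInterval K α a) (cyclicTail K α a) S T : ℕ) : ℝ) * K.choose α =
      K.factorial * RLB K α T.card := by
  have hTα : T.card ≤ α := hS ▸ card_le_card hT
  have hpos : (0 : ℝ) < α.choose T.card := by exact_mod_cast Nat.choose_pos hTα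
  have hsum := sum_choose_card_cyclicTail h0 h T.card
  have h1 : (∑ a, coverCount (cyclicInterval K α a) (cyclicTail K α a) S T) *
      (K.choose α * α.choose T.card) =
      K.factorial * (α.choose (T.card + 1) + (K - α) * (α - 1).choose T.card) := by
    rw [← hsum, sum_mul, mul_sum]
    refine sum_congr rfl fun a _ => ?_
    have := coverCount_mul (cyclicTail_subset K α a) hT
      (hS.trans (card_cyclicInterval h a).symm)
    rwa [card_cyclicInterval h, Fintype.card_fin] at this
  have h2 : ((∑ a, coverCount (cyclicInterval K α a) (cyclicTail K α a) S T : ℕ) : ℝ) *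
      (K.choose α * α.choose T.card) =
      K.factorial * (α.choose (T.card + 1) + ((K : ℝ) - α) * (α - 1).choose T.card) := by
    rw [← Nat.cast_sub h]
    exact_mod_cast h1
  rw [RLB, mul_div_assoc', eq_div_iff hpos.ne', ← h2]
  ring

theorem sum_RLB_card_cachers_le {K α f B : ℕ} (h0 : 1 ≤ α) (h : α < K) {Z : Placement K α f B}
    (hZ : IsSelfish Z) {R : ℝ}
    (hs : ∀ d : Demand K α f, d.IsValid → ∃ l : ℕ, (l : ℝ) ≤ R * B ∧ CanServe Z d l) :
    ∑ p, RLB K α (cachers Z p).card ≤ numFiles K α f * (R * B) := by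
  classical
  have hC : (0 : ℝ) < K.choose α := by exact_mod_cast Nat.choose_pos h.le
  have hF : (0 : ℝ) < K.factorial := by exact_mod_cast K.factorial_pos
  have h1 : ((∑ π : Equiv.Perm (Fin K), ∑ i : Fin f, ∑ a : Fin K,
      (univ.filter fun p : LibFile K α f × Fin B => p.1.1 = i ∧
      (cyclicInterval K α a).map π.toEmbedding = p.1.2.1 ∧
        cachers Z p ⊆ (cyclicTail K α a).map π.toEmbedding).card : ℕ) : ℝ) ≤
      K.factorial * (f * (R * B)) := by
    have : ∀ (π : Equiv.Perm (Fin K)) (i : Fin f), ((∑ a : Fin K,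
      (univ.filter fun p : LibFile K α f × Fin B => p.1.1 = i ∧
      (cyclicInterval K α a).map π.toEmbedding = p.1.2.1 ∧
        cachers Z p ⊆ (cyclicTail K α a).map π.toEmbedding).card : ℕ) : ℝ) ≤ R * B := by
      intro π i
      obtain ⟨l, hl, hsl⟩ := hs _ (cyclicDemand_isValid h0 h.le π i)
      exact le_trans (by exact_mod_cast sum_card_cover_le h0 h π i hsl) hl
    rw [Nat.cast_sum]
    refine (sum_le_sum fun π _ => ?_).trans_eq
      (b := ∑ _π : Equiv.Perm (Fin K), (f : ℝ) * (R * B)) ?_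
    · rw [Nat.cast_sum]
      refine (sum_le_sum fun i _ => this π i).trans_eq ?_
      simp
    · simp [Fintype.card_perm]
  have h2 : (∑ π : Equiv.Perm (Fin K), ∑ i : Fin f, ∑ a : Fin K,
      (univ.filter fun p : LibFile K α f × Fin B => p.1.1 = i ∧
      (cyclicInterval K α a).map π.toEmbedding = p.1.2.1 ∧
        cachers Z p ⊆ (cyclicTail K α a).map π.toEmbedding).card) =
      ∑ p : LibFile K α f × Fin B, ∑ a,
        coverCount (cyclicInterval K α a) (cyclicTail K α a) p.1.2.1 (cachers Z p) := by
    simp_rw [coverCount, card_filter, ite_and]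
    calc _ = ∑ π : Equiv.Perm (Fin K), ∑ p : LibFile K α f × Fin B, ∑ a : Fin K,
          if (cyclicInterval K α a).map π.toEmbedding = p.1.2.1 then
            if cachers Z p ⊆ (cyclicTail K α a).map π.toEmbedding then 1 else 0
          else 0 := by
          refine sum_congr rfl fun π _ => ?_
          rw [sum_congr rfl fun i _ => sum_comm, sum_comm]
          refine sum_congr rfl fun p _ => ?_
          rw [sum_comm]
          refine sum_congr rfl fun a _ => ?_
          -- Each bit matches exactly one file index `i`.
          rw [sum_ite_eq, if_pos (mem_univ _)]
      _ = _ := by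
          rw [sum_comm]
          exact sum_congr rfl fun p _ => sum_comm
  rw [h2, Nat.cast_sum] at h1
  have h3 : (∑ p : LibFile K α f × Fin B, ((∑ a,
        coverCount (cyclicInterval K α a) (cyclicTail K α a) p.1.2.1 (cachers Z p) : ℕ) : ℝ)) *
      K.choose α = K.factorial * ∑ p, RLB K α (cachers Z p).card := by
    rw [sum_mul, mul_sum]
    exact sum_congr rfl fun p _ => sum_coverCount h0 h.le _ _ p.1.2.2 (hZ.cachers_subset p)
  have h4 := mul_le_mul_of_nonneg_right h1 hC.le
  rw [h3, mul_assoc] at h4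
  refine (le_of_mul_le_mul_left h4 hF).trans_eq ?_
  rw [numFiles]
  push_cast
  ring

/-! ### The converse bound -/

/-- Jensen's inequality via the tangent at `t`: the memory limit bounds the total number of cachers
by `t * N * B`, and the nonnegative `s` gives the inequality the right direction. -/
theorem Achievable.RLB_le {K α f t : ℕ} (hf : 1 ≤ f) (h0 : 1 ≤ α) (h : α < K) (ht : t ≤ α)
    {R : ℝ} (hR : Achievable K α f ((t : ℝ) * numFiles K α f / K) R) : RLB K α t ≤ R := by
  obtain ⟨B, hB, Z, hZ, hM, hs⟩ := hR
  have hN : (0 : ℝ) < numFiles K α f := by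
    exact_mod_cast Nat.mul_pos hf (Nat.choose_pos h.le)
  have hB' : (0 : ℝ) < B := by exact_mod_cast hB
  have hK : (0 : ℝ) < K := by exact_mod_cast (by omega : 0 < K)
  obtain ⟨s, hs0, hline⟩ := exists_tangent_le_RLB (K := K) h0 h.le ht
  have hcard : Fintype.card (LibFile K α f × Fin B) = numFiles K α f * B := by
    rw [Fintype.card_prod, card_libFile, Fintype.card_fin]
  have hmem : ((∑ p, (cachers Z p).card : ℕ) : ℝ) ≤ t * (numFiles K α f * B) := by
    rw [sum_card_cachers, Nat.cast_sum]
    refine (sum_le_sum fun k _ => hM k).trans_eq ?_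
    rw [sum_const, card_univ, Fintype.card_fin, nsmul_eq_mul]
    field_simp
  have h1 : numFiles K α f * B * RLB K α t ≤ ∑ p, RLB K α (cachers Z p).card := by
    have h2 : ∑ p : LibFile K α f × Fin B, (RLB K α t + s * ((t : ℝ) - (cachers Z p).card)) ≤
        ∑ p, RLB K α (cachers Z p).card := by
      refine sum_le_sum fun p _ => hline _ ?_
      exact (card_le_card (hZ.cachers_subset p)).trans_eq p.1.2.2
    rw [sum_add_distrib, ← mul_sum, sum_sub_distrib, sum_const, sum_const, card_univ, hcard,
      nsmul_eq_mul, nsmul_eq_mul] at h2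
    push_cast at h2 hmem
    have h3 := mul_nonneg hs0 (sub_nonneg.2 hmem)
    linarith
  have h2 := h1.trans (sum_RLB_card_cachers_le h0 h hZ hs)
  refine le_of_mul_le_mul_left (a := (numFiles K α f : ℝ) * B) ?_ (by positivity)
  linarith

/-- Broadcasting the whole library serves every demand. -/
theorem achievable_numFiles (K α f : ℕ) {M : ℝ} (hM : 0 ≤ M) :
    Achievable K α f M (numFiles K α f) := by
  refine ⟨1, one_pos, fun _ => ∅, fun k p hp => by simp at hp, fun k => by simpa using hM,
    fun d _ => ⟨numFiles K α f, by simp, ?_⟩⟩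
  let e : LibFile K α f ≃ Fin (numFiles K α f) := Fintype.equivFinOfCardEq (card_libFile K α f)
  refine ⟨fun W j => W (e.symm j) 0, fun k x _ _ => x (e (d k)), fun W k => ?_⟩
  funext b
  simp [Subsingleton.elim b 0]

/-- Some achievable load must be exhibited, since `sInf ∅ = 0` in `ℝ` would spoil the bound. -/
theorem RLB_le_Rstar {K α f t : ℕ} (hf : 1 ≤ f) (h0 : 1 ≤ α) (h : α < K) (ht : t ≤ α) :
    RLB K α t ≤ Rstar K α f t :=
  le_csInf ⟨_, achievable_numFiles K α f (by positivity)⟩ fun _ hR => hR.RLB_le hf h0 h ht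

end SelfishCaching

theorem corollary1 (K f : ℕ) (hK : 1 ≤ K) (hf : 1 ≤ f) :
    (∀ α : ℕ, 1 ≤ α → α ≤ K - 1 →
      (∀ t : ℕ, t ≤ α - 1 →
        1 ≤ SelfishCaching.Rstar K α f t / SelfishCaching.RMAN K t) ∧
      (∀ t : ℕ, 0 < t → t < α - 1 →
        1 < SelfishCaching.Rstar K α f t / SelfishCaching.RMAN K t) ∧
      (∀ t : ℕ, t ≤ α - 1 →
        SelfishCaching.RLB K α t / SelfishCaching.RMAN K t ≤
          SelfishCaching.Rstar K α f t / SelfishCaching.RMAN K t ∧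
        SelfishCaching.RLB K α t / SelfishCaching.RMAN K t =
          1 + (t : ℝ) * ((K : ℝ) - (α : ℝ)) * ((α : ℝ) - 1 - (t : ℝ)) /
            ((α : ℝ) * ((K : ℝ) - (t : ℝ))))) ∧
    (∀ t : ℕ, t ≤ K → SelfishCaching.RLB K K t = SelfishCaching.RMAN K t) := by
  refine ⟨fun α h0 hαK => ?_, fun t _ => by simp [SelfishCaching.RLB, SelfishCaching.RMAN]⟩
  have h : α < K := by omega
  have hα : (0 : ℝ) < α := by exact_mod_cast h0
  have hKα : (0 : ℝ) < (K : ℝ) - α := sub_pos.2 (by exact_mod_cast h)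
  have hKt : ∀ t ≤ α - 1, (0 : ℝ) < (K : ℝ) - t := fun t ht =>
    sub_pos.2 (by exact_mod_cast (by omega : t < K))
  have hle : ∀ t ≤ α - 1, SelfishCaching.RLB K α t / SelfishCaching.RMAN K t ≤
      SelfishCaching.Rstar K α f t / SelfishCaching.RMAN K t := fun t ht =>
    div_le_div_of_nonneg_right (SelfishCaching.RLB_le_Rstar hf h0 h (by omega))
      (by unfold SelfishCaching.RMAN; positivity)
  have heq := fun t ht => SelfishCaching.RLB_div_RMAN (K := K) (α := α) (t := t) h0 h ht
  have hcast : ∀ t ≤ α - 1, (t : ℝ) ≤ (α : ℝ) - 1 := fun t ht => by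
    have : t + 1 ≤ α := by omega
    have : (t : ℝ) + 1 ≤ α := by exact_mod_cast this
    linarith
  refine ⟨fun t ht => ?_, fun t ht0 ht => ?_, fun t ht => ⟨hle t ht, heq t ht⟩⟩
  · refine le_trans ?_ (hle t ht)
    rw [heq t ht, le_add_iff_nonneg_right]
    have h1 := sub_nonneg.2 (hcast t ht)
    have h2 := hKt t ht
    positivity
  · refine lt_of_lt_of_le ?_ (hle t ht.le)
    rw [heq t ht.le, lt_add_iff_pos_right]
    have h1 : (0 : ℝ) < (α : ℝ) - 1 - t := by
      have : t + 1 < α := by omega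
      have : (t : ℝ) + 1 < α := by exact_mod_cast this
      linarith
    have h2 := hKt t ht.le
    have h3 : (0 : ℝ) < t := by exact_mod_cast ht0
    positivity
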